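/- Let $L=K_1\cup K_2$ be an oriented ordered 2-component virtual link, given by a virtual link diagram; it is considered through the Gauss diagram of that diagram. The Gauss diagram consists of two oriented circles (the preimages of $K_1$ and $K_2$) and of one arrow for each classical crossing $c$, which points from the preimage of the overcrossing (the tail) to the preimage of the undercrossing (the head) and carries the sign $w(c)\in\{\pm1\}$. Two Gauss diagrams represent the same virtual link if and only if they are related by finitely many (oriented) Reidemeister moves 1, 2, 3; the moves that involve virtual crossings do not change the Gauss diagram. The virtual link $L$ is *classical* if it is represented by the Gauss diagram of some link diagram without virtual crossings, i.e. of a 4-valent graph drawn on the sphere with over/under information at its vertices. (In terms of the graph with its cyclic orders of the half-edges at the vertices: gluing a disc to each face yields a union of spheres.) Let $r_\pm$ be the number of arrows of sign $\pm$ from $K_1$ to $K_2$, and $l_\pm$ the number of those from $K_2$ to $K_1$. Put $$lk(L)=\tfrac12(r_+-r_-+l_+-l_-),\qquad span(L)=|r_+-r_--l_++l_-|.$$ Let $l_1,l_2$ be the universal covers of the two circles, oriented lines. Label the segments of each line by integers, so that along the orientation the label increases by one at a positive tail or a negative head (of any arrow, between the two circles or not) and decreases by one at a positive head or a negative tail.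 Choose a lift of each end of each arrow. For an arrow $c$ between different circles let $N(c)$ be the label of the segment just behind the lifted head minus the label of the segment just before the lifted tail, as an element of $\mathbb Z/span(L)$. The *linking polynomial* is $$L_{K_1\cup K_2}(t)=F(t)G(t),\qquad F(t)=\sum_{c:\,l_1\to l_2}w(c)\,t^{N(c)},\qquad G(t)=\sum_{c:\,l_2\to l_1}w(c)\,t^{N(c)},$$ an element of the group ring of $\mathbb Z/span(L)$ over $\mathbb Z$, written with powers of $t$ (the ring $\mathbb Z[t^{\pm1}]$ if $span(L)=0$). **Proposition.** If $L$ is a classical 2-component link, then $span(L)=0$, $lk(L)$ is an integer, and $$L_{K_1\cup K_2}(t)=(lk(L))^2.$$ This holds for every virtual link diagram that represents $L$, every labelling and every choice of lifts (and labellings and lifts exist). -/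

import Mathlib

/-- An endpoint of an arrow of a Gauss diagram: the name of the crossing, whether this is the
preimage of the overcrossing (the tail of the arrow) or of the undercrossing (the head of the
arrow), and the sign (writhe) of the crossing. -/
@[ext]
structure Letter where
  crossing : ℕ
  isOver : Bool
  sign : ℤˣ
deriving DecidableEq

namespace Letter

/-- The other endpoint of the same arrow. -/
def mate (x : Letter) : Letter := ⟨x.crossing, !x.isOver, x.sign⟩

/-- The change of the integer label when one walks past an endpoint: a positive tail or a negative
head increases it by one, a positive head or a negative tail decreases it by one. -/
def step (x : Letter) : ℤ := if x.isOver then (x.sign : ℤ) else -(x.sign : ℤ)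

end Letter

/-- A Gauss diagram of an oriented, ordered 2-component virtual link diagram. `word 0` and `word 1`
list the endpoints on the circles of `K₁` and `K₂` in the order in which they are met along the
orientation, from a base point (the list is empty for a circle without endpoints). Virtual
crossings leave no trace in a Gauss diagram. -/
structure GaussDiagram where
  word : Fin 2 → List Letter
  /-- No endpoint is listed twice. -/
  nodup : ((word 0 ++ word 1).map fun x => (x.crossing, x.isOver)).Nodup
  /-- Both endpoints of every arrow are there, and carry the same sign. -/
  mate_mem : ∀ x ∈ word 0 ++ word 1, x.mate ∈ word 0 ++ word 1

namespace GaussDiagram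

variable (D : GaussDiagram)

/-- All endpoints. -/
def letters : List Letter := D.word 0 ++ D.word 1

/-! ### Generalized Reidemeister equivalence

The virtual moves do not change the Gauss diagram, so only the three classical moves (in all
oriented versions) are left. -/

/-- `y` directly follows `x` on one of the circles (away from the base point). -/
def Consecutive (x y : Letter) : Prop := ∃ i, [x, y] <:+: D.word i

/-- `x`, `y` are consecutive in this order if `ε = 1`, and in the opposite order if `ε = -1`. -/
def ConsecutiveAs (ε : ℤˣ) (x y : Letter) : Prop :=
  if ε = 1 then D.Consecutive x y else D.Consecutive y x

/-- Elementary moves between Gauss diagrams. -/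
inductive Move : GaussDiagram → GaussDiagram → Prop
  /-- Change of the base points. -/
  | rotate (D D' : GaussDiagram) (h : ∀ i, D.word i ~r D'.word i) : Move D D'
  /-- Change of the names of the crossings. -/
  | relabel (D D' : GaussDiagram) (f : Equiv.Perm ℕ)
      (h : ∀ i, D'.word i = (D.word i).map fun x => ⟨f x.crossing, x.isOver, x.sign⟩) : Move D D'
  /-- First Reidemeister move: remove an arrow whose two endpoints are adjacent. -/
  | reidemeister1 (D D' : GaussDiagram) (x : Letter) (hx : D.Consecutive x x.mate)
      (h : ∀ i, D'.word i = (D.word i).filter fun z => z.crossing ≠ x.crossing) : Move D D'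
  /-- Second Reidemeister move: remove two arrows of opposite signs whose tails are adjacent and
  whose heads are adjacent (the two strands being parallel or antiparallel). -/
  | reidemeister2 (D D' : GaussDiagram) (x y : Letter) (hx : x.isOver = true) (hy : y.isOver = true)
      (hsign : y.sign = -x.sign) (htails : D.Consecutive x y)
      (hheads : D.Consecutive x.mate y.mate ∨ D.Consecutive y.mate x.mate)
      (h : ∀ i, D'.word i =
        (D.word i).filter fun z => z.crossing ≠ x.crossing ∧ z.crossing ≠ y.crossing) :
      Move D D'
  /-- Third Reidemeister move: a top strand crosses a middle strand at `a` and a bottom strand at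
  `b`, and the middle strand crosses the bottom strand at `c` (`a`, `b`, `c` denote the over
  endpoints). The three strands bound a triangle, and the move exchanges the two adjacent endpoints
  on each of them. If three oriented lines in the plane meet pairwise with these signs, then the
  orders of the crossings on them are as stated, for one of the two values of `κ`. -/
  | reidemeister3 (D D' : GaussDiagram) (a b c : Letter) (κ : ℤˣ)
      (ha : a.isOver = true) (hb : b.isOver = true) (hc : c.isOver = true)
      (hab : a.crossing ≠ b.crossing) (hac : a.crossing ≠ c.crossing)
      (hbc : b.crossing ≠ c.crossing)
      (htop : D.ConsecutiveAs (κ * b.sign) a b)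
      (hmiddle : D.ConsecutiveAs (κ * c.sign) a.mate c)
      (hbottom : D.ConsecutiveAs (κ * a.sign * b.sign * c.sign) b.mate c.mate)
      (h : ∀ i, D'.word i = (D.word i).map
        (Equiv.swap a b * Equiv.swap a.mate c * Equiv.swap b.mate c.mate : Equiv.Perm Letter)) :
      Move D D'

/-- Two Gauss diagrams represent the same virtual link. -/
def Equivalent (D D' : GaussDiagram) : Prop := Relation.EqvGen Move D D'

/-! ### Classical links

Without virtual crossings, a link diagram is a 4-valent graph drawn on the sphere. It is recovered
from its Gauss diagram as a graph with a cyclic order of the half-edges at every vertex, and such a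
graph can be drawn on the sphere if and only if all the closed surfaces obtained by gluing a disc
to each of its faces are spheres. -/

/-- The half-edges of the underlying 4-valent graph: at each endpoint of an arrow the strand has an
outgoing (`true`) and an incoming (`false`) half-edge. -/
abbrev Dart : Type := {x : Letter // x ∈ D.letters} × Bool

/-- The endpoint which follows a given one on its circle. -/
def next : Equiv.Perm Letter := (D.word 0).formPerm * (D.word 1).formPerm

/-- `d` and `e` are the two halves of the same edge. -/
def Opposite (d e : D.Dart) : Prop :=
  (d.2 = true ∧ e.2 = false ∧ e.1.1 = D.next d.1.1) ∨
    (d.2 = false ∧ e.2 = true ∧ d.1.1 = D.next e.1.1)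

/-- `e` comes directly after `d` in the counterclockwise order around a crossing. This order is
over-out, under-out, over-in, under-in at a positive crossing, and
over-out, under-in, over-in, under-out at a negative one. -/
def Counterclockwise (d e : D.Dart) : Prop :=
  e.1.1 = d.1.1.mate ∧
    e.2 = if (d.1.1.isOver = true ↔ d.1.1.sign = 1) then d.2 else !d.2

/-- One step along the boundary of a face. -/
def FaceStep (d e : D.Dart) : Prop := ∃ d', D.Opposite d d' ∧ D.Counterclockwise d' e

/-- The number of vertices (crossings). -/
def numVertices : ℕ := D.letters.countP fun x => x.isOver

/-- The number of edges (each endpoint of an arrow is the start of exactly one). -/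
def numEdges : ℕ := D.letters.length

/-- The number of faces. -/
noncomputable def numFaces : ℕ := Nat.card (Quot D.FaceStep)

/-- The number of connected components of the graph (circles without crossings, which can always
be drawn apart from the rest, are not counted). -/
noncomputable def numComponents : ℕ :=
  Nat.card (Quot fun d e : D.Dart => D.Opposite d e ∨ D.Counterclockwise d e)

/-- The Gauss diagram of a link diagram without virtual crossings: the surfaces in question have
total Euler characteristic twice their number. -/
def IsPlanar : Prop :=
  (D.numVertices : ℤ) - D.numEdges + D.numFaces = 2 * D.numComponents

/-- The virtual link represented by `D` is a classical link. -/
def IsClassical : Prop := ∃ D' : GaussDiagram, D'.IsPlanar ∧ D.Equivalent D'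

/-! ### Linking number and linking polynomial -/

/-- The arrows from the circle `i` to the circle `j`, given by their tails. -/
def arcs (i j : Fin 2) : List Letter :=
  (D.word i).filter fun x => x.isOver = true ∧ x.mate ∈ D.word j

/-- The number of positive minus the number of negative arrows from circle `i` to circle `j`. -/
def signSum (i j : Fin 2) : ℤ := ((D.arcs i j).map fun x => (x.sign : ℤ)).sum

/-- The linking number: half the sum of the signs of the crossings of `K₁` with `K₂`. -/
def linkingNumber : ℚ := (1 / 2) * ((D.signSum 0 1 : ℚ) + (D.signSum 1 0 : ℚ))

/-- The span `|r₊ - r₋ - l₊ + l₋|`. -/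
def span : ℕ := (D.signSum 0 1 - D.signSum 1 0).natAbs

/-- The endpoint number `k` on the universal cover of the circle `i`. -/
def lineLetter (i : Fin 2) (k : ℤ) : Option Letter :=
  (D.word i)[(k % ((D.word i).length : ℤ)).toNat]?

/-- A labelling of the segments of the two lines: `lab i k` is the label of the segment before
endpoint number `k`, and `lab i (k + 1)` that of the segment behind it. -/
def IsLabelling (lab : Fin 2 → ℤ → ℤ) : Prop :=
  ∀ i k x, D.lineLetter i k = some x → lab i (k + 1) = lab i k + x.step

/-- A choice, for each endpoint, of a lift to the line which covers its circle. -/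
def IsLift (pos : Letter → ℤ) : Prop :=
  ∀ i, ∀ x ∈ D.word i, D.lineLetter i (pos x) = some x

/-- The number `N` of a lifted arrow with tail `x` on line `i` and head on line `j`, modulo the
span: the label of the segment behind the head minus that of the segment before the tail. -/
def arcIndex (lab : Fin 2 → ℤ → ℤ) (pos : Letter → ℤ) (i j : Fin 2) (x : Letter) :
    ZMod D.span :=
  ((lab j (pos x.mate + 1) - lab i (pos x) : ℤ) : ZMod D.span)

/-- The sum of `w(c) t ^ N(c)` over the arrows `c` from line `i` to line `j`, in the group ring
of `ℤ / span` (which is the ring of Laurent polynomials when the span is zero). -/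
noncomputable def arcPoly (lab : Fin 2 → ℤ → ℤ) (pos : Letter → ℤ) (i j : Fin 2) :
    AddMonoidAlgebra ℤ (ZMod D.span) :=
  ((D.arcs i j).map fun x =>
    AddMonoidAlgebra.single (D.arcIndex lab pos i j x) (x.sign : ℤ)).sum

/-- `P` is the product `F(t) G(t)` computed from some labelling and some choice of lifts. -/
def IsLinkingPolynomial (P : AddMonoidAlgebra ℤ (ZMod D.span)) : Prop :=
  ∃ (lab : Fin 2 → ℤ → ℤ) (pos : Letter → ℤ), D.IsLabelling lab ∧ D.IsLift pos ∧
    P = D.arcPoly lab pos 0 1 * D.arcPoly lab pos 1 0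

end GaussDiagram

/-!
For a diagram of span zero the labels do not change in total along a circle, so they live on the
circles themselves and are unique up to a constant on each of them. Changing these constants
multiplies `F` and `G` by inverse powers of `t`. The property which passes from planar diagrams to
all equivalent ones is therefore `HasBalancedIndex n`: for the labels that start with zero at the
base points, `F = n t ^ d` and `G = n t ^ (-d)` for some `d`. It determines the numbers of arrows in
the two directions, counted with signs, as `n`, so the span is zero, the linking number is `n` and
`F G = n ^ 2`.

Invariance under the moves is a local computation (`Move.hasBalancedIndex_iff`). The first and the
second Reidemeister move remove neighbouring endpoints with opposite steps, which leaves the other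
labels alone; in the second move the two removed arrows have equal indices and opposite signs. The
third move shifts the labels at the two ends of each arrow by the same amount.

A planar diagram has an Alexander numbering (`IsPlanar.exists_numbering`): a function on the faces
which jumps by one across every edge. It exists because the sum of all oriented edges is a cycle,
and on a union of spheres every cycle is a boundary (`IsPlanar.range_jump_eq`), which over `ℚ`
follows from the Euler characteristic by counting dimensions. The values of the numbering on the
left-hand sides of the edges are labels for which all arrows have index zero, so that
`HasBalancedIndex` holds with `n` the signed number of arrows in one direction.
-/

/-! ### Endpoints and labels along a word -/

namespace Letter

@[simp] theorem mate_mate (x : Letter) : x.mate.mate = x := by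
  cases x; simp [mate]

@[simp] theorem mate_crossing (x : Letter) : x.mate.crossing = x.crossing := rfl

@[simp] theorem mate_isOver (x : Letter) : x.mate.isOver = !x.isOver := rfl

@[simp] theorem mate_sign (x : Letter) : x.mate.sign = x.sign := rfl

theorem mate_ne (x : Letter) : x.mate ≠ x := fun h => by
  simpa using congrArg isOver h

theorem mate_inj {x y : Letter} : x.mate = y.mate ↔ x = y :=
  ⟨fun h => by simpa using congrArg mate h, fun h => h ▸ rfl⟩

@[simp] theorem step_mate (x : Letter) : x.mate.step = -x.step := by
  cases h : x.isOver <;> simp [step, h]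

theorem step_of_over {x : Letter} (h : x.isOver = true) : x.step = x.sign := by simp [step, h]

end Letter

/-- The change of the label along a list of endpoints. -/
def stepSum (w : List Letter) : ℤ := (w.map Letter.step).sum

@[simp] theorem stepSum_nil : stepSum [] = 0 := rfl

@[simp] theorem stepSum_cons (x : Letter) (w : List Letter) :
    stepSum (x :: w) = x.step + stepSum w := by simp [stepSum]

@[simp] theorem stepSum_append (v w : List Letter) :
    stepSum (v ++ w) = stepSum v + stepSum w := by simp [stepSum]

/-- The label of the segment before the endpoint `z` if the segment at the beginning of the list
`w` has label zero. If `z` does not occur, this is the label at the end of the list. -/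
def labelBefore (w : List Letter) (z : Letter) : ℤ := stepSum (w.takeWhile fun u => u ≠ z)

@[simp] theorem labelBefore_nil (z : Letter) : labelBefore [] z = 0 := rfl

theorem labelBefore_cons (x : Letter) (w : List Letter) (z : Letter) :
    labelBefore (x :: w) z = if x = z then 0 else x.step + labelBefore w z := by
  by_cases h : x = z <;> simp [labelBefore, h]

@[simp] theorem labelBefore_cons_self (x : Letter) (w : List Letter) :
    labelBefore (x :: w) x = 0 := by
  simp [labelBefore_cons]

theorem labelBefore_append_left {v : List Letter} (w : List Letter) {z : Letter} (h : z ∈ v) :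
    labelBefore (v ++ w) z = labelBefore v z := by
  induction v with
  | nil => simp at h
  | cons x v ih =>
    by_cases hx : x = z
    · simp [hx]
    · have : z ∈ v := by simpa [Ne.symm hx] using h
      simp [labelBefore_cons, hx, ih this]

theorem labelBefore_append_right {v : List Letter} (w : List Letter) {z : Letter} (h : z ∉ v) :
    labelBefore (v ++ w) z = stepSum v + labelBefore w z := by
  induction v with
  | nil => simp
  | cons x v ih =>
    simp only [List.mem_cons, not_or] at h
    simp [labelBefore_cons, Ne.symm h.1, ih h.2, add_assoc]

theorem labelBefore_getElem {w : List Letter} (hw : w.Nodup) (k : ℕ) (hk : k < w.length) :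
    labelBefore w w[k] = stepSum (w.take k) := by
  have h : w.take k ++ w[k] :: w.drop (k + 1) = w := by simp
  calc labelBefore w w[k] = labelBefore (w.take k ++ w[k] :: w.drop (k + 1)) w[k] := by rw [h]
    _ = stepSum (w.take k) := ?_
  rw [labelBefore_append_right]
  · rw [labelBefore_cons_self, add_zero]
  · intro hmem
    obtain ⟨m, hm, h⟩ := List.getElem_of_mem hmem
    rw [List.getElem_take] at h
    have := (List.Nodup.getElem_inj_iff hw).1 h
    simp at hm
    omega

theorem stepSum_take_succ {w : List Letter} {k : ℕ} (hk : k < w.length) :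
    stepSum (w.take (k + 1)) = stepSum (w.take k) + w[k].step := by
  rw [List.take_add_one, List.getElem?_eq_getElem hk, Option.toList_some, stepSum_append,
    stepSum_cons, stepSum_nil, add_zero]

theorem labelBefore_of_infix {w : List Letter} (hw : w.Nodup) {x y : Letter}
    (h : [x, y] <:+: w) : labelBefore w y = labelBefore w x + x.step := by
  obtain ⟨p, q, rfl⟩ := h
  simp only [List.append_assoc, List.cons_append, List.nil_append] at hw ⊢
  have hd := List.nodup_append.1 hw
  have hx : x ∉ p := fun hp => hd.2.2 x hp x (by simp) rfl
  have hy : y ∉ p := fun hp => hd.2.2 y hp y (by simp) rfl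
  have hxy : x ≠ y := by
    have := (List.nodup_cons.1 hd.2.1).1
    exact fun h => this (by simp [h])
  rw [labelBefore_append_right _ hx, labelBefore_append_right _ hy]
  simp [labelBefore_cons, hxy]

/-- Removing two adjacent endpoints with opposite steps does not change the other labels. -/
theorem labelBefore_filter_pair {w : List Letter} (hw : w.Nodup) {x y : Letter}
    (h : [x, y] <:+: w) (hstep : x.step + y.step = 0) {z : Letter} (hx : z ≠ x) (hy : z ≠ y) :
    labelBefore (w.filter fun u => u ≠ x ∧ u ≠ y) z = labelBefore w z := by
  obtain ⟨p, q, rfl⟩ := h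
  have hd := List.nodup_append.1 hw
  have hd' := List.nodup_append.1 hd.1
  have hp : (p.filter fun u => u ≠ x ∧ u ≠ y) = p := by
    rw [List.filter_eq_self]
    intro u hu
    have h1 := hd'.2.2 u hu x (by simp)
    have h2 := hd'.2.2 u hu y (by simp)
    simp [h1, h2]
  have hq : (q.filter fun u => u ≠ x ∧ u ≠ y) = q := by
    rw [List.filter_eq_self]
    intro u hu
    have h1 := hd.2.2 x (by simp) u hu
    have h2 := hd.2.2 y (by simp) u hu
    simp [h1.symm, h2.symm]
  rw [List.filter_append, List.filter_append, hp, hq]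
  by_cases hzp : z ∈ p
  · simp [labelBefore_append_left _ hzp]
  · simp only [List.append_assoc]
    rw [labelBefore_append_right _ hzp, labelBefore_append_right _ hzp]
    simp [labelBefore_cons, hx.symm, hy.symm]
    linarith

theorem map_swap_eq {p q : List Letter} {x y : Letter} (hw : (p ++ [x, y] ++ q).Nodup) :
    (p ++ [x, y] ++ q).map (Equiv.swap x y) = p ++ [y, x] ++ q := by
  have hd := List.nodup_append.1 hw
  have hd' := List.nodup_append.1 hd.1
  have hp : p.map (Equiv.swap x y) = p := by
    conv_rhs => rw [← List.map_id p]
    refine List.map_congr_left fun u hu => Equiv.swap_apply_of_ne_of_ne ?_ ?_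
    · exact hd'.2.2 u hu x (by simp)
    · exact hd'.2.2 u hu y (by simp)
  have hq : q.map (Equiv.swap x y) = q := by
    conv_rhs => rw [← List.map_id q]
    refine List.map_congr_left fun u hu => Equiv.swap_apply_of_ne_of_ne ?_ ?_
    · exact (hd.2.2 x (by simp) u hu).symm
    · exact (hd.2.2 y (by simp) u hu).symm
  rw [List.map_append, List.map_append, hp, hq]
  simp

/-- Exchanging two adjacent endpoints changes the labels before these two only. -/
theorem labelBefore_map_swap {w : List Letter} (hw : w.Nodup) {x y : Letter}
    (h : [x, y] <:+: w) (z : Letter) :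
    labelBefore (w.map (Equiv.swap x y)) z =
      labelBefore w z + if z = x then y.step else if z = y then -x.step else 0 := by
  obtain ⟨p, q, rfl⟩ := h
  rw [map_swap_eq hw]
  have hd := List.nodup_append.1 hw
  have hd' := List.nodup_append.1 hd.1
  have hx : x ∉ p := fun hp => hd'.2.2 x hp x (by simp) rfl
  have hy : y ∉ p := fun hp => hd'.2.2 y hp y (by simp) rfl
  have hxy : x ≠ y := by
    have := (List.nodup_cons.1 hd'.2.1).1
    exact fun h => this (by simp [h])
  simp only [List.append_assoc]
  by_cases hzp : z ∈ p
  · have h1 : z ≠ x := fun h => hx (h ▸ hzp)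
    have h2 : z ≠ y := fun h => hy (h ▸ hzp)
    simp [labelBefore_append_left _ hzp, h1, h2]
  · rw [labelBefore_append_right _ hzp, labelBefore_append_right _ hzp]
    by_cases h1 : z = x
    · subst h1
      simp [labelBefore_cons, hxy.symm]
    · by_cases h2 : z = y
      · subst h2
        simp [labelBefore_cons, hxy, hxy.symm]
      · simp [labelBefore_cons, h1, h2, Ne.symm h1, Ne.symm h2]
        ring

theorem labelBefore_map {w : List Letter} {g : Letter → Letter} (hg : Function.Injective g)
    (hstep : ∀ x, (g x).step = x.step) (z : Letter) :
    labelBefore (w.map g) (g z) = labelBefore w z := by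
  induction w with
  | nil => simp
  | cons x w ih => simp [labelBefore_cons, ih, hstep, hg.eq_iff]

/-- Moving the base point of a closed word shifts all labels by the same amount. -/
theorem exists_labelBefore_isRotated {w w' : List Letter} (hw : w.Nodup) (h : w ~r w')
    (h0 : stepSum w = 0) : ∃ e : ℤ, ∀ z ∈ w, labelBefore w' z = labelBefore w z + e := by
  obtain ⟨n, rfl⟩ := h
  rw [List.rotate_eq_drop_append_take_mod]
  set a := w.take (n % w.length) with ha
  set b := w.drop (n % w.length) with hb
  have hab : a ++ b = w := List.take_append_drop _ _
  rw [← hab] at hw h0 ⊢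
  have hd := (List.nodup_append.1 hw).2.2
  rw [stepSum_append] at h0
  refine ⟨stepSum b, fun z hz => ?_⟩
  rcases List.mem_append.1 hz with hz | hz
  · have hzb : z ∉ b := fun h => hd z hz z h rfl
    rw [labelBefore_append_left _ hz, labelBefore_append_right _ hzb, add_comm]
  · have hza : z ∉ a := fun h => hd z h z hz rfl
    rw [labelBefore_append_left _ hz, labelBefore_append_right _ hza]
    linarith

/-! ### Endpoints and arrows of a Gauss diagram -/

namespace GaussDiagram

variable (D : GaussDiagram)

theorem nodup_letters : D.letters.Nodup := List.Nodup.of_map _ D.nodup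

theorem nodup_word (i : Fin 2) : (D.word i).Nodup := by
  have h := List.nodup_append.1 D.nodup_letters
  fin_cases i
  · exact h.1
  · exact h.2.1

variable {D}

theorem mem_letters {x : Letter} : x ∈ D.letters ↔ ∃ i, x ∈ D.word i := by
  simp [letters, Fin.exists_fin_two]

theorem eq_of_mem_word {x : Letter} {i j : Fin 2} (hi : x ∈ D.word i) (hj : x ∈ D.word j) :
    i = j := by
  have h := (List.nodup_append.1 D.nodup_letters).2.2
  fin_cases i <;> fin_cases j
  · rfl
  · exact absurd rfl (h x hi x hj)
  · exact absurd rfl (h x hj x hi)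
  · rfl

/-- Every endpoint lies on exactly one of the two circles. -/
theorem not_mem_word_iff {x : Letter} {i j : Fin 2} (hij : i ≠ j) (hx : x ∈ D.letters) :
    x ∉ D.word i ↔ x ∈ D.word j := by
  obtain ⟨k, hk⟩ := mem_letters.1 hx
  have h : k = i ∨ k = j := by omega
  rcases h with rfl | rfl
  · exact ⟨fun h => absurd hk h, fun h => absurd (eq_of_mem_word hk h) hij⟩
  · exact ⟨fun _ => hk, fun _ h => hij (eq_of_mem_word h hk)⟩

theorem mate_mem_letters {x : Letter} (h : x ∈ D.letters) : x.mate ∈ D.letters := D.mate_mem x h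

/-- The name of a crossing and the bit `isOver` determine an endpoint. -/
theorem eq_of_crossing {x y : Letter} (hx : x ∈ D.letters) (hy : y ∈ D.letters)
    (hc : x.crossing = y.crossing) (ho : x.isOver = y.isOver) : x = y :=
  List.inj_on_of_nodup_map D.nodup hx hy (by simp [hc, ho])

theorem crossing_eq_iff {x y : Letter} (hx : x ∈ D.letters) (hy : y ∈ D.letters) :
    x.crossing = y.crossing ↔ x = y ∨ x = y.mate := by
  constructor
  · intro hc
    by_cases ho : x.isOver = y.isOver
    · exact Or.inl (eq_of_crossing hx hy hc ho)
    · refine Or.inr (eq_of_crossing hx (mate_mem_letters hy) hc ?_)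
      cases hx' : x.isOver <;> cases hy' : y.isOver <;> simp_all
  · rintro (rfl | rfl) <;> rfl

theorem Consecutive.infix {x y : Letter} (h : D.Consecutive x y) : [x, y] <:+: D.letters := by
  obtain ⟨i, h⟩ := h
  refine h.trans ?_
  fin_cases i
  · exact (List.prefix_append _ _).isInfix
  · exact (List.suffix_append _ _).isInfix

theorem Consecutive.mem_left {x y : Letter} (h : D.Consecutive x y) : x ∈ D.letters :=
  h.infix.subset (by simp)

theorem Consecutive.mem_right {x y : Letter} (h : D.Consecutive x y) : y ∈ D.letters :=
  h.infix.subset (by simp)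

/-- Consecutive endpoints lie on the same circle. -/
theorem Consecutive.mem_word_iff {x y : Letter} (h : D.Consecutive x y) (i : Fin 2) :
    x ∈ D.word i ↔ y ∈ D.word i := by
  obtain ⟨j, h⟩ := h
  have hx : x ∈ D.word j := h.subset (by simp)
  have hy : y ∈ D.word j := h.subset (by simp)
  exact ⟨fun h => eq_of_mem_word hx h ▸ hy, fun h => eq_of_mem_word hy h ▸ hx⟩

theorem mem_arcs {i j : Fin 2} {x : Letter} :
    x ∈ D.arcs i j ↔ x ∈ D.word i ∧ x.isOver = true ∧ x.mate ∈ D.word j := by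
  simp [arcs]

theorem nodup_arcs (i j : Fin 2) : (D.arcs i j).Nodup := (D.nodup_word i).filter _

theorem signSum_eq_sum (i j : Fin 2) :
    D.signSum i j = ∑ x ∈ (D.arcs i j).toFinset, (x.sign : ℤ) :=
  (List.sum_toFinset _ (nodup_arcs i j)).symm

/-- The labels along a circle change by the difference of the numbers of outgoing and of incoming
arrows, since the two steps of an arrow from the circle to itself cancel. -/
theorem stepSum_word {i j : Fin 2} (hij : i ≠ j) :
    stepSum (D.word i) = D.signSum i j - D.signSum j i := by
  set S := (D.word i).toFinset with hS
  have h1 : stepSum (D.word i) = ∑ x ∈ S, x.step :=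
    (List.sum_toFinset _ (D.nodup_word i)).symm
  have hover : ∑ x ∈ S with x.isOver = true ∧ x.mate ∉ S, x.step = D.signSum i j := by
    rw [signSum_eq_sum]
    refine Finset.sum_congr ?_ fun x hx => ?_
    · ext x
      simp only [hS, Finset.mem_filter, List.mem_toFinset, mem_arcs]
      refine and_congr_right fun hx => and_congr_right fun _ => ?_
      exact not_mem_word_iff hij (mate_mem_letters (mem_letters.2 ⟨i, hx⟩))
    · exact Letter.step_of_over (mem_arcs.1 (List.mem_toFinset.1 hx)).2.1
  have hunder : ∑ x ∈ S with x.isOver = false ∧ x.mate ∉ S, x.step = -D.signSum j i := by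
    rw [signSum_eq_sum, ← Finset.sum_neg_distrib]
    refine Finset.sum_bij' (fun x _ => x.mate) (fun x _ => x.mate) ?_ ?_ (by simp) (by simp) ?_
    · intro x hx
      simp only [hS, Finset.mem_filter, List.mem_toFinset] at hx
      simp only [List.mem_toFinset, mem_arcs, Letter.mate_mate]
      exact ⟨(not_mem_word_iff hij (mate_mem_letters (mem_letters.2 ⟨i, hx.1⟩))).1 hx.2.2,
        by simp [hx.2.1], hx.1⟩
    · intro x hx
      simp only [List.mem_toFinset, mem_arcs] at hx
      simp only [hS, Finset.mem_filter, List.mem_toFinset, Letter.mate_mate]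
      exact ⟨hx.2.2, by simp [hx.2.1],
        (not_mem_word_iff hij (mem_letters.2 ⟨j, hx.1⟩)).2 hx.1⟩
    · intro x hx
      simp only [Finset.mem_filter] at hx
      simp [Letter.step, hx.2.1]
  have hself : ∑ x ∈ S with x.mate ∈ S, x.step = 0 := by
    refine Finset.sum_involution (fun x _ => x.mate) (by simp) (fun x _ _ => x.mate_ne) ?_ (by simp)
    intro x hx
    simpa [and_comm] using hx
  rw [h1, ← Finset.sum_filter_add_sum_filter_not S (fun x => x.mate ∈ S), hself,
    ← Finset.sum_filter_add_sum_filter_not _ (fun x => x.isOver = true), Finset.filter_filter,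
    Finset.filter_filter]
  simp only [Bool.not_eq_true, and_comm (a := _ ∉ S)]
  rw [hover, hunder]
  ring

end GaussDiagram

/-! ### Invariance under the Reidemeister moves -/

/-- `x` and `y` are neighbours in `w`, in this order if `ε = 1` and in the opposite order if
`ε = -1`. -/
def AdjacentAs (w : List Letter) (ε : ℤˣ) (x y : Letter) : Prop :=
  if ε = 1 then [x, y] <:+: w else [y, x] <:+: w

theorem AdjacentAs.map {w : List Letter} {ε : ℤˣ} {x y : Letter} (h : AdjacentAs w ε x y)
    (g : Letter → Letter) : AdjacentAs (w.map g) ε (g x) (g y) := by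
  unfold AdjacentAs at *
  split_ifs at * with hε
  · exact h.map g
  · exact h.map g

theorem AdjacentAs.labelBefore_map_swap {w : List Letter} (hw : w.Nodup) {ε : ℤˣ}
    {x y : Letter} (h : AdjacentAs w ε x y) (z : Letter) :
    labelBefore (w.map (Equiv.swap x y)) z =
      labelBefore w z + if z = x then ε * y.step else if z = y then -(ε * x.step) else 0 := by
  unfold AdjacentAs at h
  rcases Int.units_eq_one_or ε with rfl | rfl
  · rw [if_pos rfl] at h
    simpa using _root_.labelBefore_map_swap hw h z
  · rw [if_neg (by decide)] at h
    have hxy : x ≠ y := by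
      rintro rfl
      simpa using hw.sublist h.sublist
    rw [Equiv.swap_comm, _root_.labelBefore_map_swap hw h z]
    by_cases hx : z = x
    · subst hx
      simp [hxy]
    · simp [hx]

namespace GaussDiagram

variable (D : GaussDiagram)

/-- The index of an arrow with tail `x`, for the labels which vanish at the base point of the first
circle and for which the second circle continues where the first one ends. -/
def baseIndex (x : Letter) : ℤ :=
  labelBefore D.letters x.mate + x.mate.step - labelBefore D.letters x

/-- The sum of `w(c) t ^ N(c)` over the arrows `c` from the circle `i` to the circle `j`, as a
Laurent polynomial, where `N(c)` is `baseIndex`. -/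
noncomputable def basePoly (i j : Fin 2) : AddMonoidAlgebra ℤ ℤ :=
  ∑ x ∈ (D.arcs i j).toFinset, AddMonoidAlgebra.single (D.baseIndex x) (x.sign : ℤ)

/-- All arrows between the two circles cancel except for `n` in each direction, and these have
opposite indices `d` and `-d`. -/
def HasBalancedIndex (n : ℤ) : Prop :=
  ∃ d : ℤ, D.basePoly 0 1 = AddMonoidAlgebra.single d n ∧
    D.basePoly 1 0 = AddMonoidAlgebra.single (-d) n

variable {D}

theorem signSum_eq_of_basePoly {i j : Fin 2} {d n : ℤ}
    (h : D.basePoly i j = AddMonoidAlgebra.single d n) : D.signSum i j = n := by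
  have := congrArg (AddMonoidAlgebra.lift ℤ ℤ ℤ 1) h
  simp only [basePoly, map_sum, AddMonoidAlgebra.lift_single, MonoidHom.one_apply, smul_eq_mul,
    mul_one] at this
  rw [signSum_eq_sum, this]

theorem HasBalancedIndex.signSum {n : ℤ} (h : D.HasBalancedIndex n) :
    D.signSum 0 1 = n ∧ D.signSum 1 0 = n := by
  obtain ⟨d, h1, h2⟩ := h
  exact ⟨signSum_eq_of_basePoly h1, signSum_eq_of_basePoly h2⟩

theorem hasBalancedIndex_congr {D' : GaussDiagram} (h01 : D.basePoly 0 1 = D'.basePoly 0 1)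
    (h10 : D.basePoly 1 0 = D'.basePoly 1 0) (n : ℤ) :
    D.HasBalancedIndex n ↔ D'.HasBalancedIndex n := by
  simp [HasBalancedIndex, h01, h10]

theorem labelBefore_letters_zero {z : Letter} (h : z ∈ D.word 0) :
    labelBefore D.letters z = labelBefore (D.word 0) z :=
  labelBefore_append_left _ h

theorem labelBefore_letters_one {z : Letter} (h : z ∈ D.word 1) :
    labelBefore D.letters z = stepSum (D.word 0) + labelBefore (D.word 1) z :=
  labelBefore_append_right _
    ((not_mem_word_iff (by decide) (mem_letters.2 ⟨1, h⟩)).2 h)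

/-- If the labels on the two circles are shifted by constants then the indices of all arrows from
one circle to the other are shifted by the difference of these constants. -/
theorem exists_basePoly_of_labelBefore {D' : GaussDiagram}
    (hmem : ∀ i z, z ∈ D'.word i ↔ z ∈ D.word i) (e : Fin 2 → ℤ)
    (he : ∀ i, ∀ z ∈ D.word i, labelBefore D'.letters z = labelBefore D.letters z + e i)
    (i j : Fin 2) :
    D'.basePoly i j = D.basePoly i j * AddMonoidAlgebra.single (e j - e i) 1 := by
  have harcs : (D'.arcs i j).toFinset = (D.arcs i j).toFinset := by
    ext z
    simp [mem_arcs, hmem]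
  rw [basePoly, basePoly, harcs, Finset.sum_mul]
  refine Finset.sum_congr rfl fun z hz => ?_
  obtain ⟨h1, -, h2⟩ := mem_arcs.1 (List.mem_toFinset.1 hz)
  rw [AddMonoidAlgebra.single_mul_single, mul_one, baseIndex, baseIndex, he i z h1,
    he j _ h2]
  congr 1
  ring

/-- Since no label changes in total along a circle, new base points only shift the labels on each
circle, which multiplies the two Laurent polynomials by inverse powers of `t`. -/
theorem HasBalancedIndex.rotate {D' : GaussDiagram} {n : ℤ} (h : ∀ i, D.word i ~r D'.word i)
    (hD : D.HasBalancedIndex n) : D'.HasBalancedIndex n := by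
  have hs := hD.signSum
  have h0 : stepSum (D.word 0) = 0 := by
    rw [stepSum_word (j := 1) (by decide), hs.1, hs.2, sub_self]
  have h1 : stepSum (D.word 1) = 0 := by
    rw [stepSum_word (j := 0) (by decide), hs.1, hs.2, sub_self]
  have h0' : stepSum (D'.word 0) = 0 := by
    rw [← h0]
    exact ((h 0).perm.symm.map Letter.step).sum_eq
  obtain ⟨e0, he0⟩ := exists_labelBefore_isRotated (D.nodup_word 0) (h 0) h0
  obtain ⟨e1, he1⟩ := exists_labelBefore_isRotated (D.nodup_word 1) (h 1) h1
  have hmem : ∀ i z, z ∈ D'.word i ↔ z ∈ D.word i := fun i z => (h i).perm.symm.mem_iff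
  have key := exists_basePoly_of_labelBefore hmem ![e0, e1] (by
    intro i z hz
    match i, hz with
    | 0, hz =>
      rw [labelBefore_letters_zero hz, labelBefore_letters_zero ((hmem 0 z).2 hz), he0 z hz]
      rfl
    | 1, hz =>
      rw [labelBefore_letters_one hz, labelBefore_letters_one ((hmem 1 z).2 hz), he1 z hz, h0, h0',
        add_assoc]
      rfl)
  obtain ⟨d, hd1, hd2⟩ := hD
  refine ⟨d + (e1 - e0), ?_, ?_⟩
  · rw [key, hd1, AddMonoidAlgebra.single_mul_single, mul_one]
    rfl
  · rw [key, hd2, AddMonoidAlgebra.single_mul_single, mul_one]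
    congr 1
    simp
    ring

theorem letters_eq_map {D' : GaussDiagram} {g : Letter → Letter}
    (h : ∀ i, D'.word i = (D.word i).map g) : D'.letters = D.letters.map g := by
  simp [letters, h]

theorem letters_eq_filter {D' : GaussDiagram} {p : Letter → Bool}
    (h : ∀ i, D'.word i = (D.word i).filter p) : D'.letters = D.letters.filter p := by
  simp [letters, h]

theorem basePoly_relabel {D' : GaussDiagram} (f : Equiv.Perm ℕ)
    (h : ∀ i, D'.word i = (D.word i).map fun x => ⟨f x.crossing, x.isOver, x.sign⟩)
    (i j : Fin 2) : D.basePoly i j = D'.basePoly i j := by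
  set g : Letter → Letter := fun x => ⟨f x.crossing, x.isOver, x.sign⟩ with hg
  have hinj : Function.Injective g := fun x y hxy => by
    simp only [hg, Letter.mk.injEq, EmbeddingLike.apply_eq_iff_eq] at hxy
    exact Letter.ext hxy.1 hxy.2.1 hxy.2.2
  have hstep : ∀ x, (g x).step = x.step := fun x => rfl
  have hmate : ∀ x, (g x).mate = g x.mate := fun x => rfl
  have harcs : (D'.arcs i j).toFinset = (D.arcs i j).toFinset.map ⟨g, hinj⟩ := by
    ext z
    simp only [List.mem_toFinset, mem_arcs, h, Finset.mem_map, Function.Embedding.coeFn_mk,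
      List.mem_map]
    constructor
    · rintro ⟨⟨x, hx, rfl⟩, ho, y, hy, hyx⟩
      rw [hmate] at hyx
      exact ⟨x, ⟨hx, ho, hinj hyx ▸ hy⟩, rfl⟩
    · rintro ⟨x, ⟨hx, ho, hm⟩, rfl⟩
      exact ⟨⟨x, hx, rfl⟩, ho, x.mate, hm, rfl⟩
  rw [basePoly, basePoly, harcs, Finset.sum_map]
  refine Finset.sum_congr rfl fun x _ => ?_
  simp only [Function.Embedding.coeFn_mk, baseIndex, letters_eq_map h, hmate,
    labelBefore_map hinj hstep, hstep]
  rfl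

theorem basePoly_reidemeister1 {D' : GaussDiagram} {x : Letter} (hx : D.Consecutive x x.mate)
    (h : ∀ i, D'.word i = (D.word i).filter fun z => z.crossing ≠ x.crossing)
    {i j : Fin 2} (hij : i ≠ j) : D.basePoly i j = D'.basePoly i j := by
  have hcross : ∀ z ∈ D.letters, (z.crossing ≠ x.crossing ↔ z ≠ x ∧ z ≠ x.mate) :=
    fun z hz => by rw [Ne, crossing_eq_iff hz hx.mem_left, not_or]
  have hlet : D'.letters = D.letters.filter fun z => z ≠ x ∧ z ≠ x.mate := by
    rw [letters_eq_filter h]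
    exact List.filter_congr fun z hz => by simp only [hcross z hz]
  -- The removed arrow joins a circle to itself, so that it does not contribute.
  have hne : ∀ z ∈ D.arcs i j, z.crossing ≠ x.crossing := by
    intro z hz
    obtain ⟨h1, -, h2⟩ := mem_arcs.1 hz
    rw [hcross z (mem_letters.2 ⟨i, h1⟩)]
    constructor
    · rintro rfl
      exact hij (eq_of_mem_word ((hx.mem_word_iff i).1 h1) h2)
    · rintro rfl
      rw [Letter.mate_mate] at h2
      exact hij (eq_of_mem_word ((hx.mem_word_iff i).2 h1) h2)
  have harcs : (D'.arcs i j).toFinset = (D.arcs i j).toFinset := by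
    ext z
    simp only [List.mem_toFinset, mem_arcs, h, List.mem_filter, decide_eq_true_eq,
      Letter.mate_crossing]
    exact ⟨fun hz => ⟨hz.1.1, hz.2.1, hz.2.2.1⟩, fun hz =>
      ⟨⟨hz.1, hne z (mem_arcs.2 hz)⟩, hz.2.1, hz.2.2, decide_eq_true (hne z (mem_arcs.2 hz))⟩⟩
  rw [basePoly, basePoly, harcs]
  refine Finset.sum_congr rfl fun z hz => ?_
  rw [List.mem_toFinset] at hz
  have hzl : z ∈ D.letters := mem_letters.2 ⟨i, (mem_arcs.1 hz).1⟩
  have h1 := (hcross z hzl).1 (hne z hz)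
  have h2 := (hcross z.mate (mate_mem_letters hzl)).1 (hne z hz)
  rw [baseIndex, baseIndex, hlet,
    labelBefore_filter_pair D.nodup_letters hx.infix (by simp) h1.1 h1.2,
    labelBefore_filter_pair D.nodup_letters hx.infix (by simp) h2.1 h2.2]

theorem basePoly_reidemeister2 {D' : GaussDiagram} {x y : Letter} (hx : x.isOver = true)
    (hy : y.isOver = true) (hsign : y.sign = -x.sign) (htails : D.Consecutive x y)
    (hheads : D.Consecutive x.mate y.mate ∨ D.Consecutive y.mate x.mate)
    (h : ∀ i, D'.word i =
      (D.word i).filter fun z => z.crossing ≠ x.crossing ∧ z.crossing ≠ y.crossing)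
    (i j : Fin 2) : D.basePoly i j = D'.basePoly i j := by
  have hxy : x ≠ y := by
    rintro rfl
    simpa using D.nodup_letters.sublist htails.infix.sublist
  have hstep : x.step + y.step = 0 := by
    simp [Letter.step_of_over, hx, hy, hsign]
  have hcross : ∀ z ∈ D.letters, (z.crossing ≠ x.crossing ∧ z.crossing ≠ y.crossing ↔
      (z ≠ x ∧ z ≠ y) ∧ z ≠ x.mate ∧ z ≠ y.mate) := fun z hz => by
    rw [Ne, Ne, crossing_eq_iff hz htails.mem_left, crossing_eq_iff hz htails.mem_right]
    tauto
  have hover : ∀ {u v : Letter}, u.isOver = true → v.isOver = true → u.mate ≠ v := by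
    rintro u v hu hv rfl
    simp [hu] at hv
  set w := D.letters.filter fun z => z ≠ x ∧ z ≠ y with hw
  have hlet : D'.letters = w.filter fun z => z ≠ x.mate ∧ z ≠ y.mate := by
    rw [letters_eq_filter h, hw, List.filter_filter]
    refine List.filter_congr fun z hz => ?_
    simp only [hcross z hz]
    by_cases h1 : z = x <;> by_cases h2 : z = y <;> simp [h1, h2]
  have hwn : w.Nodup := D.nodup_letters.filter _
  have hpair : ∀ u v : Letter, D.Consecutive u.mate v.mate → u.isOver = true → v.isOver = true →
      [u.mate, v.mate] <:+: w := by
    intro u v huv hu hv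
    have := huv.infix.filter (fun z => decide (z ≠ x ∧ z ≠ y))
    rwa [List.filter_eq_self.2] at this
    simp [hover hu hx, hover hu hy, hover hv hx, hover hv hy]
  have hlab : ∀ z ∈ D.letters, z.crossing ≠ x.crossing ∧ z.crossing ≠ y.crossing →
      labelBefore D'.letters z = labelBefore D.letters z := by
    intro z hz hzc
    obtain ⟨⟨h1, h2⟩, h3, h4⟩ := (hcross z hz).1 hzc
    rw [← labelBefore_filter_pair D.nodup_letters htails.infix hstep h1 h2, hlet]
    rcases hheads with hh | hh
    · refine labelBefore_filter_pair hwn (hpair x y hh hx hy) ?_ h3 h4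
      rw [Letter.step_mate, Letter.step_mate]
      linarith
    · rw [← labelBefore_filter_pair hwn (hpair y x hh hy hx) ?_ h4 h3]
      · simp only [and_comm, hw]
      · rw [Letter.step_mate, Letter.step_mate]
        linarith
  -- The two arrows have the same index, so that they cancel.
  have hidx : D.baseIndex x = D.baseIndex y := by
    have h1 := labelBefore_of_infix D.nodup_letters htails.infix
    simp only [baseIndex, Letter.step_mate]
    rcases hheads with hh | hh
    · have h2 := labelBefore_of_infix D.nodup_letters hh.infix
      rw [Letter.step_mate] at h2
      linarith
    · have h2 := labelBefore_of_infix D.nodup_letters hh.infix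
      rw [Letter.step_mate] at h2
      linarith
  have hheads' : ∀ k, x.mate ∈ D.word k ↔ y.mate ∈ D.word k := by
    intro k
    rcases hheads with hh | hh
    · exact hh.mem_word_iff k
    · exact (hh.mem_word_iff k).symm
  have hmem : x ∈ D.arcs i j ↔ y ∈ D.arcs i j := by
    simp [mem_arcs, hx, hy, hheads', htails.mem_word_iff]
  rw [basePoly, basePoly, ← Finset.sum_filter_add_sum_filter_not _
    (fun z => z.crossing ≠ x.crossing ∧ z.crossing ≠ y.crossing)]
  have hcancel : ∑ z ∈ (D.arcs i j).toFinset with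
      ¬(z.crossing ≠ x.crossing ∧ z.crossing ≠ y.crossing),
      AddMonoidAlgebra.single (D.baseIndex z) (z.sign : ℤ) = 0 := by
    have hset : ∀ z ∈ D.arcs i j, (¬(z.crossing ≠ x.crossing ∧ z.crossing ≠ y.crossing) ↔
        z = x ∨ z = y) := by
      intro z hz
      obtain ⟨h1, ho, -⟩ := mem_arcs.1 hz
      rw [hcross z (mem_letters.2 ⟨i, h1⟩)]
      have h3 := (hover hx ho).symm
      have h4 := (hover hy ho).symm
      tauto
    by_cases hxa : x ∈ D.arcs i j
    · have : (D.arcs i j).toFinset.filter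
          (fun z => ¬(z.crossing ≠ x.crossing ∧ z.crossing ≠ y.crossing)) = {x, y} := by
        ext z
        simp only [Finset.mem_filter, List.mem_toFinset, Finset.mem_insert,
          Finset.mem_singleton]
        constructor
        · exact fun hz => (hset z hz.1).1 hz.2
        · intro hz
          have hza : z ∈ D.arcs i j := by
            rcases hz with rfl | rfl
            · exact hxa
            · exact hmem.1 hxa
          exact ⟨hza, (hset z hza).2 hz⟩
      rw [this, Finset.sum_pair hxy, hidx, ← AddMonoidAlgebra.single_add, hsign]
      simp
    · refine Finset.sum_eq_zero fun z hz => ?_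
      simp only [Finset.mem_filter, List.mem_toFinset] at hz
      rcases (hset z hz.1).1 hz.2 with rfl | rfl
      · exact absurd hz.1 hxa
      · exact absurd (hmem.2 hz.1) hxa
  rw [hcancel, add_zero]
  have harcs : (D'.arcs i j).toFinset = (D.arcs i j).toFinset.filter
      (fun z => z.crossing ≠ x.crossing ∧ z.crossing ≠ y.crossing) := by
    ext z
    simp only [List.mem_toFinset, mem_arcs, h, List.mem_filter, decide_eq_true_eq,
      Letter.mate_crossing, Finset.mem_filter]
    exact ⟨fun hz => ⟨⟨hz.1.1, hz.2.1, hz.2.2.1⟩, hz.1.2⟩, fun hz =>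
      ⟨⟨hz.1.1, hz.2⟩, hz.1.2.1, hz.1.2.2, decide_eq_true hz.2⟩⟩
  rw [harcs]
  refine Finset.sum_congr rfl fun z hz => ?_
  simp only [Finset.mem_filter, List.mem_toFinset] at hz
  have hzl : z ∈ D.letters := mem_letters.2 ⟨i, (mem_arcs.1 hz.1).1⟩
  rw [baseIndex, baseIndex, hlab z hzl hz.2, hlab z.mate (mate_mem_letters hzl) hz.2]

theorem ConsecutiveAs.adjacentAs {ε : ℤˣ} {x y : Letter} (h : D.ConsecutiveAs ε x y) :
    AdjacentAs D.letters ε x y := by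
  unfold ConsecutiveAs at h
  unfold AdjacentAs
  split_ifs at * with hε
  · exact h.infix
  · exact h.infix

theorem ConsecutiveAs.mem_word_iff {ε : ℤˣ} {x y : Letter} (h : D.ConsecutiveAs ε x y)
    (i : Fin 2) : x ∈ D.word i ↔ y ∈ D.word i := by
  unfold ConsecutiveAs at h
  split_ifs at h with hε
  · exact Consecutive.mem_word_iff h i
  · exact (Consecutive.mem_word_iff h i).symm

theorem ConsecutiveAs.swap_mem_word_iff {ε : ℤˣ} {x y : Letter} (h : D.ConsecutiveAs ε x y)
    (i : Fin 2) (z : Letter) : Equiv.swap x y z ∈ D.word i ↔ z ∈ D.word i := by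
  rw [Equiv.swap_apply_def]
  split_ifs with h1 h2
  · rw [h1, h.mem_word_iff]
  · rw [h2, h.mem_word_iff]
  · rfl

/-- The move shifts the labels at the two ends of each of the three arrows by the same amount: by
`κ` for `a`, by `-κ * a.sign * b.sign` for `b` and by `κ * a.sign * c.sign` for `c`. -/
theorem basePoly_reidemeister3 {D' : GaussDiagram} {a b c : Letter} {κ : ℤˣ}
    (ha : a.isOver = true) (hb : b.isOver = true) (hc : c.isOver = true)
    (hab : a.crossing ≠ b.crossing) (hac : a.crossing ≠ c.crossing)
    (hbc : b.crossing ≠ c.crossing)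
    (htop : D.ConsecutiveAs (κ * b.sign) a b)
    (hmiddle : D.ConsecutiveAs (κ * c.sign) a.mate c)
    (hbottom : D.ConsecutiveAs (κ * a.sign * b.sign * c.sign) b.mate c.mate)
    (h : ∀ i, D'.word i = (D.word i).map
      (Equiv.swap a b * Equiv.swap a.mate c * Equiv.swap b.mate c.mate : Equiv.Perm Letter))
    (i j : Fin 2) : D.basePoly i j = D'.basePoly i j := by
  have hover : ∀ {u v : Letter}, u.isOver = true → v.isOver = true → u ≠ v.mate := by
    rintro u v hu hv rfl
    simp [hv] at hu
  have hne : ∀ {u v : Letter}, u.crossing ≠ v.crossing → u ≠ v := fun huv h => huv (h ▸ rfl)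
  have hmem : ∀ k z, z ∈ D'.word k ↔ z ∈ D.word k := by
    intro k z
    set σ : Equiv.Perm Letter :=
      Equiv.swap a b * Equiv.swap a.mate c * Equiv.swap b.mate c.mate with hσ
    have hiff : ∀ x, σ x ∈ D.word k ↔ x ∈ D.word k := fun x => by
      rw [hσ, Equiv.Perm.mul_apply, Equiv.Perm.mul_apply, htop.swap_mem_word_iff,
        hmiddle.swap_mem_word_iff, hbottom.swap_mem_word_iff]
    rw [h, List.mem_map]
    constructor
    · rintro ⟨x, hx, rfl⟩
      exact (hiff x).2 hx
    · intro hz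
      exact ⟨σ.symm z, (hiff _).1 (by rwa [Equiv.apply_symm_apply]), Equiv.apply_symm_apply _ _⟩
  have hlab : ∀ z, labelBefore D'.letters z = labelBefore D.letters z +
      (if z = b.mate then ((κ * a.sign * b.sign * c.sign : ℤˣ) : ℤ) * c.mate.step else
        if z = c.mate then -(((κ * a.sign * b.sign * c.sign : ℤˣ) : ℤ) * b.mate.step) else 0) +
      (if z = a.mate then ((κ * c.sign : ℤˣ) : ℤ) * c.step else
        if z = c then -(((κ * c.sign : ℤˣ) : ℤ) * a.mate.step) else 0) +
      (if z = a then ((κ * b.sign : ℤˣ) : ℤ) * b.step else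
        if z = b then -(((κ * b.sign : ℤˣ) : ℤ) * a.step) else 0) := by
    intro z
    have hl : D'.letters = ((D.letters.map (Equiv.swap b.mate c.mate)).map
        (Equiv.swap a.mate c)).map (Equiv.swap a b) := by
      rw [letters_eq_map h]
      simp [Function.comp_def]
    have h3 := hbottom.adjacentAs
    have h2 : AdjacentAs (D.letters.map (Equiv.swap b.mate c.mate)) (κ * c.sign) a.mate c := by
      have := hmiddle.adjacentAs.map (Equiv.swap b.mate c.mate)
      rwa [Equiv.swap_apply_of_ne_of_ne (hne (u := a.mate) (v := b.mate) hab)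
          (hne (u := a.mate) (v := c.mate) hac),
        Equiv.swap_apply_of_ne_of_ne (hover hc hb) (hover hc hc)] at this
    have h1 : AdjacentAs ((D.letters.map (Equiv.swap b.mate c.mate)).map (Equiv.swap a.mate c))
        (κ * b.sign) a b := by
      have := (htop.adjacentAs.map (Equiv.swap b.mate c.mate)).map (Equiv.swap a.mate c)
      rwa [Equiv.swap_apply_of_ne_of_ne (hover ha hb) (hover ha hc),
        Equiv.swap_apply_of_ne_of_ne (hover hb hb) (hover hb hc),
        Equiv.swap_apply_of_ne_of_ne (hover ha ha) (hne hac),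
        Equiv.swap_apply_of_ne_of_ne (hover hb ha) (hne hbc)] at this
    have n3 := D.nodup_letters
    have n2 := n3.map (Equiv.swap b.mate c.mate).injective
    have n1 := n2.map (Equiv.swap a.mate c).injective
    rw [hl, h1.labelBefore_map_swap n1, h2.labelBefore_map_swap n2, h3.labelBefore_map_swap n3]
  have hidx : ∀ z : Letter, z.isOver = true → D'.baseIndex z = D.baseIndex z := by
    intro z hz
    have hab' := hne hab
    have hac' := hne hac
    have hbc' := hne hbc
    have hb2 : (b.sign : ℤ) * b.sign = 1 := Int.units_coe_mul_self _
    have hc2 : (c.sign : ℤ) * c.sign = 1 := Int.units_coe_mul_self _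
    simp only [baseIndex, hlab, Letter.mate_inj, (hover ha hz).symm, (hover hb hz).symm,
      (hover hc hz).symm, hover hz ha, hover hz hb, hover hz hc, if_false, Letter.step_mate,
      Letter.step_of_over ha, Letter.step_of_over hb, Letter.step_of_over hc]
    by_cases h1 : z = a
    · subst h1
      simp [hab', hac']
      linear_combination (κ : ℤ) * hc2 - κ * hb2
    · by_cases h2 : z = b
      · subst h2
        simp [hab'.symm, hbc']
        linear_combination -(κ * a.sign * z.sign : ℤ) * hc2
      · by_cases h3 : z = c
        · subst h3
          simp [hac'.symm, hbc'.symm]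
          linear_combination (κ * a.sign * z.sign : ℤ) * hb2
        · simp [h1, h2, h3]
  have harcs : (D'.arcs i j).toFinset = (D.arcs i j).toFinset := by
    ext z
    simp [mem_arcs, hmem]
  rw [basePoly, basePoly, harcs]
  refine Finset.sum_congr rfl fun z hz => ?_
  rw [hidx z (mem_arcs.1 (List.mem_toFinset.1 hz)).2.1]

theorem Move.hasBalancedIndex_iff {D D' : GaussDiagram} (h : Move D D') (n : ℤ) :
    D.HasBalancedIndex n ↔ D'.HasBalancedIndex n := by
  cases h with
  | rotate h => exact ⟨fun hD => hD.rotate h, fun hD => hD.rotate fun i => (h i).symm⟩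
  | relabel f h =>
    exact hasBalancedIndex_congr (basePoly_relabel f h 0 1) (basePoly_relabel f h 1 0) n
  | reidemeister1 x hx h =>
    exact hasBalancedIndex_congr (basePoly_reidemeister1 hx h (by decide))
      (basePoly_reidemeister1 hx h (by decide)) n
  | reidemeister2 x y hx hy hsign htails hheads h =>
    exact hasBalancedIndex_congr (basePoly_reidemeister2 hx hy hsign htails hheads h 0 1)
      (basePoly_reidemeister2 hx hy hsign htails hheads h 1 0) n
  | reidemeister3 a b c κ ha hb hc hab hac hbc htop hmiddle hbottom h =>
    exact hasBalancedIndex_congr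
      (basePoly_reidemeister3 ha hb hc hab hac hbc htop hmiddle hbottom h 0 1)
      (basePoly_reidemeister3 ha hb hc hab hac hbc htop hmiddle hbottom h 1 0) n

theorem Equivalent.hasBalancedIndex_iff {D D' : GaussDiagram} (h : Equivalent D D') (n : ℤ) :
    D.HasBalancedIndex n ↔ D'.HasBalancedIndex n := by
  induction h with
  | rel _ _ h => exact h.hasBalancedIndex_iff n
  | refl _ => exact Iff.rfl
  | symm _ _ _ ih => exact ih.symm
  | trans _ _ _ _ _ ih1 ih2 => exact ih1.trans ih2

end GaussDiagram

/-! ### The Alexander numbering of a planar diagram -/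

/-- A function which changes by the steps of the endpoints around a closed word differs from the
labels by a constant. -/
theorem exists_labelBefore_of_formPerm {w : List Letter} (hw : w.Nodup) {A : Letter → ℤ}
    (hA : ∀ x ∈ w, A (w.formPerm x) = A x + x.step) :
    stepSum w = 0 ∧ ∃ c, ∀ z ∈ w, labelBefore w z = A z + c := by
  rcases Nat.eq_zero_or_pos w.length with h0 | hpos
  · rw [List.length_eq_zero_iff] at h0
    subst h0
    exact ⟨rfl, 0, by simp⟩
  have key : ∀ k, ∀ hk : k < w.length, A w[k] = A w[0] + stepSum (w.take k) := by
    intro k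
    induction k with
    | zero => simp
    | succ k ih =>
      intro hk
      have hk' : k < w.length := by omega
      have h := hA w[k] (List.getElem_mem hk')
      rw [List.formPerm_apply_lt_getElem _ hw _ hk, ih hk'] at h
      rw [h, stepSum_take_succ hk', add_assoc]
  constructor
  · have hk : w.length - 1 < w.length := by omega
    have h := hA _ (List.getElem_mem hk)
    have hs := stepSum_take_succ hk
    rw [List.formPerm_apply_getElem _ hw, key _ hk] at h
    simp only [Nat.sub_add_cancel hpos, Nat.mod_self, List.take_length] at h hs
    linarith
  · refine ⟨-A w[0], fun z hz => ?_⟩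
    obtain ⟨k, hk, rfl⟩ := List.getElem_of_mem hz
    rw [labelBefore_getElem hw, key k hk]
    ring

namespace GaussDiagram

variable {D : GaussDiagram}

theorem next_of_mem_word {i : Fin 2} {x : Letter} (h : x ∈ D.word i) :
    D.next x = (D.word i).formPerm x := by
  rw [next, Equiv.Perm.mul_apply]
  match i, h with
  | 0, h =>
    rw [List.formPerm_apply_of_notMem
      ((not_mem_word_iff (by decide) (mem_letters.2 ⟨0, h⟩)).2 h)]
  | 1, h =>
    have h' := List.formPerm_apply_mem_of_mem h
    rw [List.formPerm_apply_of_notMem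
      ((not_mem_word_iff (by decide) (mem_letters.2 ⟨1, h'⟩)).2 h')]

theorem next_mem_letters {x : Letter} (h : x ∈ D.letters) : D.next x ∈ D.letters := by
  obtain ⟨i, h⟩ := mem_letters.1 h
  rw [next_of_mem_word h]
  exact mem_letters.2 ⟨i, List.formPerm_apply_mem_of_mem h⟩

/-- An Alexander numbering, which jumps by the steps of the endpoints and for which every arrow has
index zero, forces the indices of all arrows between the two circles to be opposite constants. -/
theorem hasBalancedIndex_of_numbering {A : Letter → ℤ}
    (hnext : ∀ x ∈ D.letters, A (D.next x) = A x + x.step)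
    (hmate : ∀ x ∈ D.letters, A x.mate + x.mate.step = A x) :
    ∃ n, D.HasBalancedIndex n := by
  have hword : ∀ i, stepSum (D.word i) = 0 ∧ ∃ c, ∀ z ∈ D.word i,
      labelBefore (D.word i) z = A z + c := fun i =>
    exists_labelBefore_of_formPerm (D.nodup_word i) fun x hx => by
      rw [← next_of_mem_word hx]
      exact hnext x (mem_letters.2 ⟨i, hx⟩)
  obtain ⟨h0, c0, hc0⟩ := hword 0
  obtain ⟨-, c1, hc1⟩ := hword 1
  have hpoly : ∀ i j : Fin 2, D.basePoly i j =
      AddMonoidAlgebra.single (![c0, c1] j - ![c0, c1] i) (D.signSum i j) := by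
    intro i j
    have hlab : ∀ k, ∀ z ∈ D.word k, labelBefore D.letters z = A z + ![c0, c1] k := by
      intro k z hz
      match k, hz with
      | 0, hz => rw [labelBefore_letters_zero hz, hc0 z hz]; rfl
      | 1, hz => rw [labelBefore_letters_one hz, hc1 z hz, h0, zero_add]; rfl
    rw [signSum_eq_sum, ← AddMonoidAlgebra.singleAddHom_apply, map_sum, basePoly]
    refine Finset.sum_congr rfl fun x hx => ?_
    obtain ⟨h1, -, h2⟩ := mem_arcs.1 (List.mem_toFinset.1 hx)
    rw [AddMonoidAlgebra.singleAddHom_apply, baseIndex, hlab i x h1, hlab j _ h2]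
    congr 1
    linarith [hmate x (mem_letters.2 ⟨i, h1⟩)]
  have hs : D.signSum 0 1 = D.signSum 1 0 := by
    rw [stepSum_word (j := 1) (by decide)] at h0
    linarith
  refine ⟨D.signSum 0 1, c1 - c0, hpoly 0 1, ?_⟩
  rw [hpoly, hs]
  congr 1
  simp

open Classical in
noncomputable instance : Fintype {x : Letter // x ∈ D.letters} := Fintype.ofFinite _

variable (D) in
/-- The crossings, represented by their over endpoints. -/
abbrev Vertex : Type := {x : {x : Letter // x ∈ D.letters} // x.1.isOver = true}

variable (D) in
/-- The faces of the underlying graph. The face of a half-edge lies on its right if one looks away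
from the crossing. -/
abbrev Face : Type := Quot D.FaceStep

variable (D) in
/-- The connected components of the underlying graph. -/
abbrev Component : Type := Quot fun d e : D.Dart => D.Opposite d e ∨ D.Counterclockwise d e

noncomputable instance : Fintype D.Vertex := Fintype.ofFinite _
noncomputable instance : Fintype D.Face := Fintype.ofFinite _
noncomputable instance : Fintype D.Component := Fintype.ofFinite _

theorem card_letters : Fintype.card {x : Letter // x ∈ D.letters} = D.numEdges := by
  rw [numEdges, ← List.toFinset_card_of_nodup D.nodup_letters, ← Fintype.card_coe]
  exact Fintype.card_congr (Equiv.subtypeEquivRight fun x => by simp)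

theorem card_vertex : Fintype.card D.Vertex = D.numVertices := by
  rw [numVertices, List.countP_eq_length_filter,
    ← List.toFinset_card_of_nodup (D.nodup_letters.filter _), ← Fintype.card_coe]
  exact Fintype.card_congr ((Equiv.subtypeSubtypeEquivSubtypeInter
    (fun x => x ∈ D.letters) (fun x => x.isOver = true)).trans
    (Equiv.subtypeEquivRight fun x => by simp))

theorem card_face : Fintype.card D.Face = D.numFaces := by
  rw [numFaces, Nat.card_eq_fintype_card]

theorem card_component : Fintype.card D.Component = D.numComponents := by
  rw [numComponents, Nat.card_eq_fintype_card]

variable (D) in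
/-- The permutation `next` of the endpoints of the diagram. An endpoint also stands for the edge
which starts there. -/
def nextPerm : Equiv.Perm {x : Letter // x ∈ D.letters} :=
  D.next.subtypePermOfFintype fun _ hx => next_mem_letters hx

@[simp] theorem nextPerm_coe (x : {x : Letter // x ∈ D.letters}) :
    (D.nextPerm x : Letter) = D.next x := rfl

variable (D) in
/-- The involution `mate` on the endpoints of the diagram. -/
def matePerm : Equiv.Perm {x : Letter // x ∈ D.letters} where
  toFun x := ⟨x.1.mate, mate_mem_letters x.2⟩
  invFun x := ⟨x.1.mate, mate_mem_letters x.2⟩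
  left_inv x := by simp
  right_inv x := by simp

@[simp] theorem matePerm_coe (x : {x : Letter // x ∈ D.letters}) :
    (D.matePerm x : Letter) = x.1.mate := rfl

/-- The crossing at which an endpoint lies. -/
def vertex (x : {x : Letter // x ∈ D.letters}) : D.Vertex :=
  if h : x.1.isOver = true then ⟨x, h⟩ else ⟨D.matePerm x, by simpa using h⟩

theorem vertex_of_over (x : D.Vertex) : vertex x.1 = x := by
  simp [vertex, x.2]

theorem vertex_matePerm (x : {x : Letter // x ∈ D.letters}) :
    vertex (D.matePerm x) = vertex x := by
  cases h : x.1.isOver <;> simp [vertex, h, Subtype.ext_iff]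

theorem opposite_next (x : {x : Letter // x ∈ D.letters}) :
    D.Opposite (x, true) (D.nextPerm x, false) := Or.inl ⟨rfl, rfl, rfl⟩

theorem opposite_prev (x : {x : Letter // x ∈ D.letters}) :
    D.Opposite (D.nextPerm x, false) (x, true) := Or.inr ⟨rfl, rfl, rfl⟩

theorem exists_opposite (d : D.Dart) : ∃ e, D.Opposite e d := by
  obtain ⟨x, b⟩ := d
  cases b
  · refine ⟨(D.nextPerm.symm x, true), ?_⟩
    have := opposite_next (D.nextPerm.symm x)
    rwa [Equiv.apply_symm_apply] at this
  · exact ⟨_, opposite_prev x⟩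

/-- The half-edge which comes directly after `d` around its crossing. -/
def rotateDart (d : D.Dart) : D.Dart :=
  (D.matePerm d.1, if (d.1.1.isOver = true ↔ d.1.1.sign = 1) then d.2 else !d.2)

theorem counterclockwise_rotateDart (d : D.Dart) : D.Counterclockwise d (rotateDart d) :=
  ⟨rfl, rfl⟩

variable (D) in
/-- The incidence matrix of the underlying directed graph: its transpose is the boundary operator
from edges to vertices. -/
noncomputable def incidence : Matrix {x : Letter // x ∈ D.letters} D.Vertex ℚ := open Classical in
  Matrix.of fun x v => (if vertex (D.nextPerm x) = v then 1 else 0) - if vertex x = v then 1 else 0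

theorem incidence_mulVec (h : D.Vertex → ℚ) (x : {x : Letter // x ∈ D.letters}) :
    D.incidence.mulVec h x = h (vertex (D.nextPerm x)) - h (vertex x) := by
  classical
  simp [incidence, Matrix.mulVec, dotProduct, sub_mul, Finset.sum_sub_distrib]

open Classical in
theorem incidence_transpose_mulVec (g : {x : Letter // x ∈ D.letters} → ℚ) (v : D.Vertex) :
    D.incidence.transpose.mulVec g v =
      ∑ x, if vertex x = v then g (D.nextPerm.symm x) - g x else 0 := by
  have h := Equiv.sum_comp D.nextPerm
    (fun x => if vertex x = v then g (D.nextPerm.symm x) else 0)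
  simp only [Equiv.symm_apply_apply] at h
  simp only [incidence, Matrix.mulVec, dotProduct, Matrix.transpose_apply, Matrix.of_apply, sub_mul,
    Finset.sum_sub_distrib, ite_mul, one_mul, zero_mul, h]
  rw [← Finset.sum_sub_distrib]
  exact Finset.sum_congr rfl fun x _ => by split_ifs <;> simp

variable (D) in
/-- The jump of a function on the faces across each edge, from the face on its right to the one on
its left. This is the boundary operator from faces to edges. -/
def jump : (D.Face → ℚ) →ₗ[ℚ] ({x : Letter // x ∈ D.letters} → ℚ) where
  toFun f x := f (Quot.mk _ (D.nextPerm x, false)) - f (Quot.mk _ (x, true))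
  map_add' f g := by
    ext x
    simp
    ring
  map_smul' r f := by
    ext x
    simp
    ring

/-- The boundary of a face runs along a half-edge and its other half, and then along the half-edge
which comes next counterclockwise. -/
theorem face_eq {d e : D.Dart} (h : D.Opposite d e) :
    (Quot.mk _ d : D.Face) = Quot.mk _ (rotateDart e) :=
  Quot.sound ⟨e, h, counterclockwise_rotateDart e⟩

theorem jump_apply (f : D.Face → ℚ) (x : {x : Letter // x ∈ D.letters}) :
    D.jump f x = f (Quot.mk _ (rotateDart (x, true))) - f (Quot.mk _ (x, true)) := by
  rw [← face_eq (opposite_prev x)]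
  rfl

theorem jump_symm_apply (f : D.Face → ℚ) (x : {x : Letter // x ∈ D.letters}) :
    D.jump f (D.nextPerm.symm x) =
      f (Quot.mk _ (x, false)) - f (Quot.mk _ (rotateDart (x, false))) := by
  have h := face_eq (opposite_next (D.nextPerm.symm x))
  rw [Equiv.apply_symm_apply] at h
  rw [← h]
  simp [jump]

/-- A boundary is a cycle: the four jumps around a crossing cancel. -/
theorem range_jump_le : LinearMap.range D.jump ≤
    LinearMap.ker D.incidence.transpose.mulVecLin := by
  classical
  rintro _ ⟨f, rfl⟩
  rw [LinearMap.mem_ker]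
  ext v
  rw [Matrix.mulVecLin_apply, incidence_transpose_mulVec]
  set S : {x : Letter // x ∈ D.letters} → ℚ := fun x =>
    f (Quot.mk _ (x, false)) + f (Quot.mk _ (x, true)) with hS
  have h1 : ∀ x, D.jump f (D.nextPerm.symm x) - D.jump f x = S x - S (D.matePerm x) := by
    intro x
    rw [jump_symm_apply, jump_apply]
    by_cases h : (x.1.isOver = true ↔ x.1.sign = 1)
    · simp only [rotateDart, if_pos h, hS]
      ring
    · simp only [rotateDart, if_neg h, hS, Bool.not_false, Bool.not_true]
      ring
  have h2 := Equiv.sum_comp D.matePerm (fun x => if vertex x = v then S x else 0)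
  simp only [vertex_matePerm] at h2
  have h3 : ∀ x, (if vertex x = v then S x - S (D.matePerm x) else 0) =
      (if vertex x = v then S x else 0) - if vertex x = v then S (D.matePerm x) else 0 :=
    fun x => by split_ifs <;> simp
  simp only [h1, h3, Finset.sum_sub_distrib, h2, sub_self, Pi.zero_apply]

/-- A function on the vertices which is constant along the edges is constant on components. -/
theorem finrank_ker_incidence_le :
    Module.finrank ℚ (LinearMap.ker D.incidence.mulVecLin) ≤ D.numComponents := by
  let r : (D.Component → ℚ) →ₗ[ℚ] (D.Vertex → ℚ) :=
    LinearMap.funLeft ℚ ℚ fun v => Quot.mk _ (v.1, true)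
  have hle : LinearMap.ker D.incidence.mulVecLin ≤ LinearMap.range r := by
    intro h hh
    have hh' : ∀ x, h (vertex (D.nextPerm x)) = h (vertex x) := fun x => by
      have := congrFun (LinearMap.mem_ker.1 hh) x
      rw [Matrix.mulVecLin_apply, incidence_mulVec] at this
      exact sub_eq_zero.1 this
    refine ⟨Quot.lift (fun d => h (vertex d.1)) ?_, ?_⟩
    · rintro d e ((⟨-, -, hde⟩ | ⟨-, -, hde⟩) | ⟨hde, -⟩)
      · rw [← hh' d.1]
        exact congrArg (fun x => h (vertex x)) (Subtype.ext hde).symm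
      · rw [← hh' e.1]
        exact congrArg (fun x => h (vertex x)) (Subtype.ext hde)
      · rw [← vertex_matePerm d.1]
        exact congrArg (fun x => h (vertex x)) (Subtype.ext hde).symm
    · ext v
      simp [r, LinearMap.funLeft_apply, vertex_of_over]
  calc _ ≤ Module.finrank ℚ (LinearMap.range r) := Submodule.finrank_mono hle
    _ ≤ Module.finrank ℚ (D.Component → ℚ) := LinearMap.finrank_range_le r
    _ = D.numComponents := by rw [Module.finrank_fintype_fun_eq_card, card_component]

/-- A function on the faces without jumps is constant on components. -/
theorem finrank_ker_jump_le :
    Module.finrank ℚ (LinearMap.ker D.jump) ≤ D.numComponents := by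
  let q : D.Face → D.Component := Quot.lift (fun d => Quot.mk _ d) fun d e ⟨d', h1, h2⟩ =>
    (show (Quot.mk _ d : D.Component) = Quot.mk _ d' from Quot.sound (Or.inl h1)).trans
      (Quot.sound (Or.inr h2))
  let r : (D.Component → ℚ) →ₗ[ℚ] (D.Face → ℚ) := LinearMap.funLeft ℚ ℚ q
  have hle : LinearMap.ker D.jump ≤ LinearMap.range r := by
    intro f hf
    have hf' : ∀ x, f (Quot.mk _ (D.nextPerm x, false)) = f (Quot.mk _ (x, true)) := fun x =>
      sub_eq_zero.1 (congrFun (LinearMap.mem_ker.1 hf) x)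
    have hopp : ∀ d e : D.Dart, D.Opposite d e → f (Quot.mk _ d) = f (Quot.mk _ e) := by
      rintro ⟨x, b⟩ ⟨y, b'⟩ (⟨hb, hb', h⟩ | ⟨hb, hb', h⟩)
      · obtain rfl : y = D.nextPerm x := Subtype.ext h
        simp only at hb hb'
        rw [hb, hb', hf']
      · obtain rfl : x = D.nextPerm y := Subtype.ext h
        simp only at hb hb'
        rw [hb, hb', hf']
    refine ⟨Quot.lift (fun d => f (Quot.mk _ d)) ?_, ?_⟩
    · rintro d e (h | h)
      · exact hopp d e h
      · obtain ⟨d', hd'⟩ := exists_opposite d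
        rw [← hopp d' d hd']
        exact congrArg f (Quot.sound ⟨d, hd', h⟩)
    · ext x
      induction x using Quot.ind
      rfl
  calc _ ≤ Module.finrank ℚ (LinearMap.range r) := Submodule.finrank_mono hle
    _ ≤ Module.finrank ℚ (D.Component → ℚ) := LinearMap.finrank_range_le r
    _ = D.numComponents := by rw [Module.finrank_fintype_fun_eq_card, card_component]

/-- On spheres every cycle is a boundary. With `V`, `E`, `F`, `C` for the numbers of vertices, edges,
faces and components, the cycles have dimension at most `E - (V - C)` and the boundaries at least
`F - C`, and these numbers agree since `V - E + F = 2 * C`. -/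
theorem IsPlanar.range_jump_eq (h : D.IsPlanar) : LinearMap.range D.jump =
    LinearMap.ker D.incidence.transpose.mulVecLin := by
  refine Submodule.eq_of_le_of_finrank_le range_jump_le ?_
  have h1 := D.incidence.mulVecLin.finrank_range_add_finrank_ker
  have h2 := D.incidence.transpose.mulVecLin.finrank_range_add_finrank_ker
  have h3 := D.jump.finrank_range_add_finrank_ker
  have h4 : Module.finrank ℚ (LinearMap.range D.incidence.transpose.mulVecLin) =
    Module.finrank ℚ (LinearMap.range D.incidence.mulVecLin) := D.incidence.rank_transpose
  have h5 := finrank_ker_incidence_le (D := D)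
  have h6 := finrank_ker_jump_le (D := D)
  rw [Module.finrank_fintype_fun_eq_card, card_vertex] at h1
  rw [Module.finrank_fintype_fun_eq_card, card_letters] at h2
  rw [Module.finrank_fintype_fun_eq_card, card_face] at h3
  unfold IsPlanar at h
  omega

/-- The sum of all edges is a cycle, so that on spheres it bounds. -/
theorem IsPlanar.exists_jump_eq (h : D.IsPlanar) : ∃ f : D.Face → ℚ, ∀ x, D.jump f x = -1 := by
  classical
  have hmem : (fun _ => -1 : {x : Letter // x ∈ D.letters} → ℚ) ∈ LinearMap.range D.jump := by
    rw [h.range_jump_eq, LinearMap.mem_ker]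
    ext v
    rw [Matrix.mulVecLin_apply, incidence_transpose_mulVec]
    simp
  obtain ⟨f, hf⟩ := hmem
  exact ⟨f, congrFun hf⟩

/-- The Alexander numbering: label each edge by the value on its left-hand face of a function on the
faces which jumps by one across every edge. -/
theorem IsPlanar.exists_numbering (h : D.IsPlanar) : ∃ A : Letter → ℤ,
    (∀ x ∈ D.letters, A (D.next x) = A x + x.step) ∧
      ∀ x ∈ D.letters, A x.mate + x.mate.step = A x := by
  obtain ⟨f, hf⟩ := h.exists_jump_eq
  set B : {x : Letter // x ∈ D.letters} → ℚ := fun x => f (Quot.mk _ (x, false)) with hB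
  -- Going once around the crossing of `x` determines the four values there from one of them.
  have key : ∀ x, B (D.nextPerm x) = B x + (x.1.step : ℤ) ∧
      B (D.matePerm x) = B x + (x.1.step : ℤ) := by
    intro x
    have e0 : B (D.nextPerm x) = f (Quot.mk _ (rotateDart (x, true))) :=
      congrArg f (face_eq (opposite_prev x))
    have e1 := hf x
    have e2 := hf (D.nextPerm.symm x)
    have e3 := hf (D.matePerm x)
    have e4 := hf (D.nextPerm.symm (D.matePerm x))
    rw [jump_apply] at e1 e3
    rw [jump_symm_apply] at e2 e4
    have hmm : D.matePerm (D.matePerm x) = x := Subtype.ext (by simp)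
    rw [e0]
    simp only [hB]
    rcases Int.units_eq_one_or x.1.sign with hs | hs <;> cases ho : x.1.isOver <;>
      simp [rotateDart, hs, ho, hmm, Letter.step] at e1 e2 e3 e4 ⊢ <;>
      first | linarith | constructor <;> linarith
  -- The values of `B` need not be integers, but rounding down respects the integral differences.
  refine ⟨fun x => if hx : x ∈ D.letters then ⌊B ⟨x, hx⟩⌋ else 0, fun x hx => ?_, fun x hx => ?_⟩
  · simp only [hx, next_mem_letters hx, dif_pos]
    rw [← Int.floor_add_intCast, ← (key ⟨x, hx⟩).1]
    rfl
  · simp only [hx, mate_mem_letters hx, dif_pos, Letter.step_mate]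
    have := (key ⟨x, hx⟩).2
    have h2 : B ⟨x.mate, mate_mem_letters hx⟩ = B ⟨x, hx⟩ + (x.step : ℤ) := this
    rw [h2, Int.floor_add_intCast]
    ring

theorem IsPlanar.hasBalancedIndex (h : D.IsPlanar) : ∃ n, D.HasBalancedIndex n := by
  obtain ⟨A, h1, h2⟩ := h.exists_numbering
  exact hasBalancedIndex_of_numbering h1 h2

theorem IsClassical.hasBalancedIndex (h : D.IsClassical) : ∃ n, D.HasBalancedIndex n := by
  obtain ⟨D', hp, he⟩ := h
  obtain ⟨n, hn⟩ := hp.hasBalancedIndex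
  exact ⟨n, (he.hasBalancedIndex_iff n).2 hn⟩

end GaussDiagram

/-! ### Labellings of the universal covers and the linking polynomial -/

/-- The label of the segment before the endpoint number `k` on the universal cover of the circle
with the word `w`, for the labels which vanish at the base point. -/
def cyclicSum (w : List Letter) (k : ℤ) : ℤ := stepSum (w.take (k % (w.length : ℤ)).toNat)

theorem cyclicSum_add_one {w : List Letter} (h0 : stepSum w = 0) {k : ℤ} {x : Letter}
    (hx : w[(k % (w.length : ℤ)).toNat]? = some x) :
    cyclicSum w (k + 1) = cyclicSum w k + x.step := by
  obtain ⟨hr, rfl⟩ := List.getElem?_eq_some_iff.1 hx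
  rw [cyclicSum, cyclicSum, ← stepSum_take_succ hr]
  have hpos : (0 : ℤ) < w.length := by omega
  have hnonneg := Int.emod_nonneg k hpos.ne'
  have hlt := Int.emod_lt_of_pos k hpos
  rw [← Int.emod_add_emod]
  generalize k % (w.length : ℤ) = r at *
  rcases lt_or_eq_of_le (Int.add_one_le_iff.2 hlt) with h | h
  · rw [Int.emod_eq_of_lt (by omega) h, Int.toNat_add hnonneg zero_le_one, Int.toNat_one]
  · have h' : r.toNat + 1 = w.length := by omega
    rw [h, Int.emod_self, h', List.take_length, h0]
    rfl

theorem labelBefore_eq_cyclicSum {w : List Letter} (hw : w.Nodup) {k : ℤ} {x : Letter}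
    (hx : w[(k % (w.length : ℤ)).toNat]? = some x) : labelBefore w x = cyclicSum w k := by
  obtain ⟨hr, rfl⟩ := List.getElem?_eq_some_iff.1 hx
  exact labelBefore_getElem hw _ hr

namespace GaussDiagram

variable {D : GaussDiagram}

theorem isLabelling_cyclicSum (h0 : ∀ i, stepSum (D.word i) = 0) :
    D.IsLabelling fun i => cyclicSum (D.word i) :=
  fun i _ _ hx => cyclicSum_add_one (h0 i) hx

theorem exists_isLift : ∃ pos, D.IsLift pos := by
  refine ⟨fun x => if x ∈ D.word 0 then (D.word 0).idxOf x else (D.word 1).idxOf x, ?_⟩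
  have key : ∀ i, ∀ x ∈ D.word i, D.lineLetter i ((D.word i).idxOf x) = some x := by
    intro i x hx
    have hlt := List.idxOf_lt_length_of_mem hx
    rw [lineLetter, Int.emod_eq_of_lt (by positivity) (by exact_mod_cast hlt), Int.toNat_natCast,
      List.getElem?_eq_getElem hlt, List.getElem_idxOf]
  intro i x hx
  match i, hx with
  | 0, hx =>
    simp only [if_pos hx]
    exact key 0 x hx
  | 1, hx =>
    have hx0 : x ∉ D.word 0 := (not_mem_word_iff (by decide) (mem_letters.2 ⟨1, hx⟩)).2 hx
    simp only [if_neg hx0]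
    exact key 1 x hx

/-- On a circle without total change of the label every labelling is periodic, and it is determined
up to a constant. -/
theorem IsLabelling.eq_add_labelBefore {lab : Fin 2 → ℤ → ℤ} (hlab : D.IsLabelling lab) {i : Fin 2}
    (h0 : stepSum (D.word i) = 0) {k : ℤ} {x : Letter} (hx : D.lineLetter i k = some x) :
    lab i k = labelBefore (D.word i) x + lab i 0 := by
  have hpos : (0 : ℤ) < (D.word i).length := by
    obtain ⟨hr, -⟩ := List.getElem?_eq_some_iff.1 hx
    omega
  have hstep : ∀ m, lab i (m + 1) - cyclicSum (D.word i) (m + 1) =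
      lab i m - cyclicSum (D.word i) m := by
    intro m
    have hr : (m % ((D.word i).length : ℤ)).toNat < (D.word i).length := by
      have h1 := Int.emod_nonneg m hpos.ne'
      have h2 := Int.emod_lt_of_pos m hpos
      omega
    have hm := List.getElem?_eq_getElem hr
    rw [hlab i m _ hm, cyclicSum_add_one h0 hm]
    ring
  have hconst : ∀ m, lab i m - cyclicSum (D.word i) m = lab i 0 := by
    intro m
    induction m using Int.induction_on with
    | zero => simp [cyclicSum]
    | succ m ih => rw [hstep, ih]
    | pred m ih =>
      rw [← ih, ← hstep (-m - 1), sub_add_cancel]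
  rw [labelBefore_eq_cyclicSum (D.nodup_word i) hx, ← hconst k]
  ring

/-- The labels at the base points contribute a power of `t`, and the choice of lifts does not
matter. -/
theorem arcPoly_eq {lab : Fin 2 → ℤ → ℤ} {pos : Letter → ℤ} (hlab : D.IsLabelling lab)
    (hpos : D.IsLift pos) (h0 : ∀ i, stepSum (D.word i) = 0) (i j : Fin 2) :
    D.arcPoly lab pos i j =
      AddMonoidAlgebra.mapDomainRingHom ℤ (Int.castAddHom (ZMod D.span))
        (D.basePoly i j * AddMonoidAlgebra.single (lab j 0 - lab i 0) 1) := by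
  have key : ∀ k, ∀ z ∈ D.word k, lab k (pos z) = labelBefore D.letters z + lab k 0 := by
    intro k z hz
    rw [hlab.eq_add_labelBefore (h0 k) (hpos k z hz)]
    match k, hz with
    | 0, hz => rw [labelBefore_letters_zero hz]
    | 1, hz => rw [labelBefore_letters_one hz, h0, zero_add]
  rw [arcPoly, ← List.sum_toFinset _ (nodup_arcs i j), basePoly, Finset.sum_mul, map_sum]
  refine Finset.sum_congr rfl fun x hx => ?_
  obtain ⟨h1, -, h2⟩ := mem_arcs.1 (List.mem_toFinset.1 hx)
  rw [AddMonoidAlgebra.single_mul_single, mul_one, AddMonoidAlgebra.mapDomainRingHom_apply,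
    AddMonoidAlgebra.mapDomain_single, Int.coe_castAddHom, arcIndex,
    hlab j (pos x.mate) x.mate (hpos j _ h2), key i x h1, key j _ h2, baseIndex]
  congr 2
  ring

/-- The shifts of the two factors cancel. -/
theorem HasBalancedIndex.arcPoly_mul {n : ℤ} (h : D.HasBalancedIndex n)
    {lab : Fin 2 → ℤ → ℤ} {pos : Letter → ℤ} (hlab : D.IsLabelling lab)
    (hpos : D.IsLift pos) (h0 : ∀ i, stepSum (D.word i) = 0) :
    D.arcPoly lab pos 0 1 * D.arcPoly lab pos 1 0 = AddMonoidAlgebra.single 0 (n ^ 2) := by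
  obtain ⟨d, h1, h2⟩ := h
  rw [arcPoly_eq hlab hpos h0, arcPoly_eq hlab hpos h0, ← map_mul, h1, h2]
  simp only [AddMonoidAlgebra.single_mul_single, mul_one]
  rw [AddMonoidAlgebra.mapDomainRingHom_apply, AddMonoidAlgebra.mapDomain_single, ← sq]
  congr 1
  rw [show d + (lab 1 0 - lab 0 0) + (-d + (lab 0 0 - lab 1 0)) = 0 by ring, map_zero]

end GaussDiagram

theorem proposition5p6 (D : GaussDiagram) (hD : D.IsClassical) :
    D.span = 0 ∧
      ∃ n : ℤ, D.linkingNumber = (n : ℚ) ∧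
        ∀ P : AddMonoidAlgebra ℤ (ZMod D.span),
          D.IsLinkingPolynomial P ↔ P = AddMonoidAlgebra.single 0 (n ^ 2) := by
  obtain ⟨n, hn⟩ := hD.hasBalancedIndex
  obtain ⟨h01, h10⟩ := hn.signSum
  have h0 : ∀ i, stepSum (D.word i) = 0 := by
    intro i
    match i with
    | 0 => rw [GaussDiagram.stepSum_word (j := 1) (by decide), h01, h10, sub_self]
    | 1 => rw [GaussDiagram.stepSum_word (j := 0) (by decide), h01, h10, sub_self]
  refine ⟨by simp [GaussDiagram.span, h01, h10], n, ?_, fun P => ⟨?_, ?_⟩⟩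
  · rw [GaussDiagram.linkingNumber, h01, h10]
    ring
  · rintro ⟨lab, pos, hlab, hpos, rfl⟩
    exact hn.arcPoly_mul hlab hpos h0
  · rintro rfl
    obtain ⟨pos, hpos⟩ := D.exists_isLift
    have hlab := GaussDiagram.isLabelling_cyclicSum h0
    exact ⟨_, pos, hlab, hpos, (hn.arcPoly_mul hlab hpos h0).symm⟩
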